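/- Let $K$ be an infinite field and $\Lambda$ a finite-dimensional hereditary $K$-algebra. Let $S_1,\dots,S_n$ be a complete list of pairwise non-isomorphic simple $\Lambda$-modules, $P_i$ the projective cover of $S_i$, and $P(\alpha)=\bigoplus_i P_i^{\alpha_i}$ for $\alpha\in\mathbb N^n$. The dimension vector $\underline{\dim}\,M\in\mathbb N^n$ of a finitely generated module $M$ has $i$-th coordinate $\dim_{\operatorname{End}(P_i)}\operatorname{Hom}_\Lambda(P_i,M)$ (here $\operatorname{End}_\Lambda(P_i)\cong\operatorname{End}_\Lambda(S_i)$ is a division algebra). A finitely generated module $M$ is exceptional if $\operatorname{Ext}^1_\Lambda(M,M)=0$ and $\operatorname{End}_\Lambda(M)$ is a division algebra; a real Schur root is the dimension vector $\beta$ of an exceptional module, which is then denoted $M_\beta$. Let $d_{ji}=\dim_{\operatorname{End}(S_i)}\operatorname{Ext}^1_\Lambda(S_j,S_i)$ and choose isomorphisms $\varphi_j:\bigoplus_i P_i^{d_{ji}}\cong\operatorname{rad}P_j$ for $j=1,\dots,n$. For $\alpha\in\mathbb N^n$ they give an isomorphism $\varphi_\alpha=\bigoplus_j\varphi_j^{\alpha_j}:\bigoplus_j\bigl(\bigoplus_i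 P_i^{d_{ji}}\bigr)^{\alpha_j}\cong\operatorname{rad}P(\alpha)$. The representation space $\operatorname{Rep}(\Lambda,\alpha)$ is the $K$-vector space of all $\Lambda$-homomorphisms $f:\operatorname{rad}P(\alpha)\to P(\alpha)$ such that $f\circ\varphi_\alpha$ maps each summand $P_i$ into the summand $P_i^{\alpha_i}$ of $P(\alpha)$; it carries the Zariski topology, and $f$ represents the module $N_f=\operatorname{coker}(f-\mathrm{inc}:\operatorname{rad}P(\alpha)\to P(\alpha))$. Let $\alpha_1,\dots,\alpha_k$ be real Schur roots, with exceptional modules $M_{\alpha_1},\dots,M_{\alpha_k}$, such that $\operatorname{Ext}^1_\Lambda(M_{\alpha_i},M_{\alpha_j})=0$ for all $i,j$. Let $n_1,\dots,n_k$ be nonnegative integers and $\gamma=\sum_{i=1}^k n_i\alpha_i$. Then the generic representation in $\operatorname{Rep}(\Lambda,\gamma)$ is isomorphic to $\bigoplus_{i=1}^k M_{\alpha_i}^{n_i}$; that is, for every choice of the $\varphi_j$, the set of all $f\in\operatorname{Rep}(\Lambda,\gamma)$ with $N_f\cong\bigoplus_{i=1}^k M_{\alpha_i}^{n_i}$ is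 open and dense in $\operatorname{Rep}(\Lambda,\gamma)$. -/

import Mathlib

open CategoryTheory
open scoped ModuleCat

universe u v

namespace GenericDecomposition

/-- A ring is (left) hereditary if all its left ideals are projective. Throughout, modules are
left modules. -/
def IsHereditary (Λ : Type v) [Ring Λ] : Prop :=
  ∀ I : Ideal Λ, Module.Projective Λ I

section Modules

variable {Λ : Type v} [Ring Λ]

/-- `S 0, …, S (n - 1)` is a complete irredundant list of the simple modules up to isomorphism. -/
structure IsSimpleList {n : ℕ} (S : Fin n → ModuleCat.{v} Λ) : Prop where
  simple : ∀ i, IsSimpleModule Λ (S i)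
  irredundant : ∀ i j, Nonempty (S i ≃ₗ[Λ] S j) → i = j
  complete : ∀ T : ModuleCat.{v} Λ, IsSimpleModule Λ T → ∃ i, Nonempty (T ≃ₗ[Λ] S i)

/-- `π : P → S` is a projective cover: `P` is projective, and `π` is surjective with superfluous
kernel. -/
structure IsProjectiveCover {P S : ModuleCat.{v} Λ} (π : P →ₗ[Λ] S) : Prop where
  projective : Module.Projective Λ P
  surjective : Function.Surjective π
  superfluous : ∀ N : Submodule Λ P, N ⊔ LinearMap.ker π = ⊤ → N = ⊤

/-- The direct sum `⨁ i, (X i) ^ (a i)`. The index `⟨i, r⟩` stands for the `r`-th copy of `X i`.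
For indecomposable projectives `P i` this is the module `P(a)`. -/
abbrev PowerSum {n : ℕ} (X : Fin n → ModuleCat.{v} Λ) (a : Fin n → ℕ) : Type v :=
  ∀ x : (Σ i : Fin n, Fin (a i)), X x.1

/-- The action of `End(Y)` on `Ext¹(X, Y)` by Yoneda composition. -/
noncomputable instance extEndModule (X Y : ModuleCat.{v} Λ) :
    Module (Module.End Λ Y) (Abelian.Ext X Y 1) where
  smul a e := e.comp (Abelian.Ext.mk₀ (ModuleCat.ofHom a)) (add_zero 1)
  one_smul e := Abelian.Ext.comp_mk₀_id e
  mul_smul a b e := by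
    change e.comp (Abelian.Ext.mk₀ (ModuleCat.ofHom b ≫ ModuleCat.ofHom a)) _ =
      (e.comp (Abelian.Ext.mk₀ (ModuleCat.ofHom b)) _).comp
        (Abelian.Ext.mk₀ (ModuleCat.ofHom a)) _
    rw [← Abelian.Ext.mk₀_comp_mk₀, Abelian.Ext.comp_assoc_of_third_deg_zero]
  smul_zero a := by
    change (0 : Abelian.Ext X Y 1).comp (Abelian.Ext.mk₀ (ModuleCat.ofHom a)) _ = 0
    rw [Abelian.Ext.zero_comp]
  smul_add a e e' := Abelian.Ext.add_comp _ _ _ _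
  add_smul a b e := by
    change e.comp (Abelian.Ext.mk₀ (ModuleCat.ofHom a + ModuleCat.ofHom b)) _ = _
    rw [Abelian.Ext.mk₀_add, Abelian.Ext.comp_add]
    rfl
  zero_smul e := by
    change e.comp (Abelian.Ext.mk₀ (0 : Y ⟶ Y)) _ = 0
    rw [Abelian.Ext.mk₀_zero, Abelian.Ext.comp_zero]

/-- The numbers `d j i`, the dimension of `Ext¹(S j, S i)` over the division ring `End(S i)`. -/
noncomputable def extDim {n : ℕ} (S : Fin n → ModuleCat.{v} Λ) (j i : Fin n) : ℕ :=
  Module.finrank (Module.End Λ (S i)) (Abelian.Ext (S j) (S i) 1)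

/-- The dimension vector of `M`: its `i`-th coordinate is the dimension of `Hom(P i, M)` over
`End(P i)`, which acts on the right by precomposition (`End(P i)` is a division ring for an
indecomposable projective `P i` over a hereditary algebra). -/
noncomputable def dimVec {n : ℕ} (P : Fin n → ModuleCat.{v} Λ) (M : ModuleCat.{v} Λ) :
    Fin n → ℕ :=
  fun i => Module.finrank (Module.End Λ (P i))ᵈᵐᵃ (P i →ₗ[Λ] M)

/-- A finitely generated module `M` is exceptional if `Ext¹(M, M) = 0` and `End(M)` is a division
ring. -/
structure IsExceptional (M : ModuleCat.{v} Λ) : Prop where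
  finite : Module.Finite Λ M
  rigid : Subsingleton (Abelian.Ext M M 1)
  end_nontrivial : Nontrivial (Module.End Λ M)
  end_isUnit : ∀ f : Module.End Λ M, f ≠ 0 → IsUnit f

/-- A real Schur root is the dimension vector of an exceptional module. -/
def IsRealSchurRoot {n : ℕ} (P : Fin n → ModuleCat.{v} Λ) (β : Fin n → ℕ) : Prop :=
  ∃ M : ModuleCat.{v} Λ, IsExceptional M ∧ dimVec P M = β

/-- The radical of a finite direct sum is the direct sum of the radicals. -/
theorem jacobson_powerSum {n : ℕ} (X : Fin n → ModuleCat.{v} Λ) (a : Fin n → ℕ) :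
    Module.jacobson Λ (PowerSum X a) =
      Submodule.pi Set.univ (fun x : (Σ i : Fin n, Fin (a i)) => Module.jacobson Λ (X x.1)) := by
  refine le_antisymm (Module.jacobson_pi_le Λ _) fun p hp => ?_
  have h : p = ∑ x, LinearMap.single Λ (fun x : (Σ i : Fin n, Fin (a i)) => X x.1) x (p x) := by
    simpa using (Finset.univ_sum_single p).symm
  rw [h]
  refine Submodule.sum_mem _ fun x _ => ?_
  exact Module.le_comap_jacobson
    (LinearMap.single Λ (fun x : (Σ i : Fin n, Fin (a i)) => (X x.1 : Type v)) x)
    (hp x (Set.mem_univ x))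

/-- The isomorphism `φ_α : ⨁ j, (⨁ i, P i ^ (d j i)) ^ (α j) ≃ rad P(α)` that is `φ j` on each of
the `α j` copies of `P(d j) = ⨁ i, P i ^ (d j i)`. -/
noncomputable def radEquiv {n : ℕ} (P : Fin n → ModuleCat.{v} Λ) (d : Fin n → Fin n → ℕ)
    (φ : ∀ j, PowerSum P (d j) ≃ₗ[Λ] Module.jacobson Λ (P j)) (α : Fin n → ℕ) :
    (∀ x : (Σ j : Fin n, Fin (α j)), PowerSum P (d x.1)) ≃ₗ[Λ]
      Module.jacobson Λ (PowerSum P α) where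
  toFun p := ⟨fun x => (φ x.1 (p x) : P x.1), by
    rw [jacobson_powerSum]
    exact fun x _ => (φ x.1 (p x)).2⟩
  map_add' p q := by ext x; simp
  map_smul' r p := by ext x; simp
  invFun q x := (φ x.1).symm ⟨q.1 x, Module.jacobson_pi_le Λ _ q.2 x (Set.mem_univ x)⟩
  left_inv p := by ext x; simp
  right_inv q := by ext x; simp

/-- The module `N_f = coker (f - inc : rad P(α) → P(α))`. -/
abbrev repModule {n : ℕ} {P : Fin n → ModuleCat.{v} Λ} {α : Fin n → ℕ}
    (f : Module.jacobson Λ (PowerSum P α) →ₗ[Λ] PowerSum P α) : Type v :=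
  PowerSum P α ⧸ LinearMap.range (f - (Module.jacobson Λ (PowerSum P α)).subtype)

end Modules

section Algebras

variable (K : Type u) [Field K] {Λ : Type v} [Ring Λ] [Algebra K Λ]

/-- The `K`-space `H(Λ, α)` of all homomorphisms `⨁ j, (⨁ i, P i ^ (d j i)) ^ (α j) → P(α)` that
map every summand `P i` of the source into the summand `P i ^ (α i)` of `P(α)`. -/
def blockHom {n : ℕ} (P : Fin n → ModuleCat.{v} Λ) (d : Fin n → Fin n → ℕ) (α : Fin n → ℕ) :
    Submodule K
      ((∀ x : (Σ j : Fin n, Fin (α j)), PowerSum P (d x.1)) →ₗ[Λ] PowerSum P α) where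
  carrier := {g | ∀ (x : (Σ j : Fin n, Fin (α j))) (y : (Σ i : Fin n, Fin (d x.1 i))) (p : P y.1)
    (z : (Σ i : Fin n, Fin (α i))), z.1 ≠ y.1 → g (Pi.single x (Pi.single y p)) z = 0}
  zero_mem' := fun _ _ _ _ _ => rfl
  add_mem' := fun hg hh x y p z hz => by
    simp [hg x y p z hz, hh x y p z hz]
  smul_mem' := fun c g hg x y p z hz => by
    simp [hg x y p z hz]

/-- The representation space `Rep_φ(Λ, α)`: the `K`-space of all `f : rad P(α) → P(α)` such that
`f ∘ φ_α` lies in `H(Λ, α)`. -/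
noncomputable def Rep {n : ℕ} (P : Fin n → ModuleCat.{v} Λ) (d : Fin n → Fin n → ℕ)
    (φ : ∀ j, PowerSum P (d j) ≃ₗ[Λ] Module.jacobson Λ (P j)) (α : Fin n → ℕ) :
    Submodule K (Module.jacobson Λ (PowerSum P α) →ₗ[Λ] PowerSum P α) where
  carrier := {f | f ∘ₗ (radEquiv P d φ α).toLinearMap ∈ blockHom K P d α}
  zero_mem' := (blockHom K P d α).zero_mem
  add_mem' := fun hf hg => (blockHom K P d α).add_mem hf hg
  smul_mem' := fun c _ hf => (blockHom K P d α).smul_mem c hf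

/-- The set of all `f` in `Rep_φ(Λ, α)` such that `N_f` is isomorphic to `N`. -/
def isoLocus {n : ℕ} (P : Fin n → ModuleCat.{v} Λ) (d : Fin n → Fin n → ℕ)
    (φ : ∀ j, PowerSum P (d j) ≃ₗ[Λ] Module.jacobson Λ (P j)) (α : Fin n → ℕ)
    (N : Type v) [AddCommGroup N] [Module Λ N] : Set (Rep K P d φ α) :=
  {f | Nonempty (repModule f.1 ≃ₗ[Λ] N)}

end Algebras

/-- The polynomial functions on a `K`-vector space: the functions generated, as a `K`-algebra, by
the linear forms. -/
def polyFun (K : Type u) (V : Type v) [Field K] [AddCommGroup V] [Module K V] :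
    Subalgebra K (V → K) :=
  Algebra.adjoin K (Set.range fun l : Module.Dual K V => (l : V → K))

/-- The Zariski topology on a finite-dimensional `K`-vector space: the sets where some polynomial
function does not vanish form a basis of the open sets. -/
@[reducible]
def zariski (K : Type u) (V : Type v) [Field K] [AddCommGroup V] [Module K V] :
    TopologicalSpace V :=
  TopologicalSpace.generateFrom {U | ∃ f ∈ polyFun K V, U = {x | f x ≠ 0}}

end GenericDecomposition

/-! Put `Q = rad P(γ)` and `Y = P(γ)`. For every point `f` the map `f - inc : Q → Y` is injective,
so it presents `N_f`, and comparison with `inc` itself shows that `N_f` has dimension vector `γ`.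
Conversely, a finite-dimensional module with this dimension vector is some `N_f`
(`exists_repModule_equiv`). The direct sum of the exceptional modules has dimension vector `γ`, so
its locus is nonempty. Nonempty open sets are dense over an infinite field, and openness remains.

The sum `N` is rigid, since all `Ext¹` groups between its summands vanish. For a presentation `i : Q
→ Y` of a rigid module, `(A, B) ↦ A i - i B` maps onto `Hom(Q, Y)` (`exists_comp_sub_comp_eq`): the
orbit of `i` fills its tangent space. Orbit dimensions, which are awkward over a field that is not
algebraically closed, are avoided. The linear equation `A i = i' B` for a nearby `i'` is solved by
Cramer's rule starting from `A = B = 1` (`exists_kernel_deformation`). Its solution is polynomial in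
`i'`, so `A` and `B` are invertible off the zero set of a polynomial function, and there the
cokernels of `i` and `i'` are isomorphic. -/

namespace GenericDecomposition

/-! ### Polynomial functions and the Zariski topology -/

section Polynomial

variable {K : Type u} [Field K] {V : Type v} [AddCommGroup V] [Module K V]

theorem dual_mem_polyFun (l : Module.Dual K V) : (fun x => l x) ∈ polyFun K V :=
  Algebra.subset_adjoin ⟨l, rfl⟩

theorem const_mem_polyFun (c : K) : (fun _ => c) ∈ polyFun K V :=
  (polyFun K V).algebraMap_mem c

/-- Polynomial functions pull back along maps whose coordinates are polynomial functions. -/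
theorem comp_mem_polyFun {W : Type*} [AddCommGroup W] [Module K W] {G : V → W}
    (hG : ∀ l : Module.Dual K W, (fun x => l (G x)) ∈ polyFun K V) {D : W → K}
    (hD : D ∈ polyFun K W) : (fun x => D (G x)) ∈ polyFun K V := by
  induction hD using Algebra.adjoin_induction with
  | mem f hf => obtain ⟨l, rfl⟩ := hf; exact hG l
  | algebraMap r => exact const_mem_polyFun r
  | add f g _ _ hf hg => exact (polyFun K V).add_mem hf hg
  | mul f g _ _ hf hg => exact (polyFun K V).mul_mem hf hg

theorem matrix_det_mem_polyFun {ι : Type*} [Fintype ι] [DecidableEq ι] {T : V → Matrix ι ι K}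
    (hT : ∀ i j, (fun x => T x i j) ∈ polyFun K V) : (fun x => (T x).det) ∈ polyFun K V := by
  have h : (fun x => (T x).det) = ∑ σ : Equiv.Perm ι,
      (Equiv.Perm.sign σ : ℤ) • ∏ i, fun x => T x (σ i) i := by
    ext x
    simp [Matrix.det_apply, Units.smul_def]
  rw [h]
  exact (polyFun K V).sum_mem fun σ _ =>
    zsmul_mem ((polyFun K V).prod_mem fun i _ => hT _ _) _

theorem matrix_adjugate_mem_polyFun {ι : Type*} [Fintype ι] [DecidableEq ι]
    {T : V → Matrix ι ι K} (hT : ∀ i j, (fun x => T x i j) ∈ polyFun K V) (i j : ι) :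
    (fun x => (T x).adjugate i j) ∈ polyFun K V := by
  simp only [Matrix.adjugate_apply]
  refine matrix_det_mem_polyFun fun a b => ?_
  by_cases h : a = j
  · subst h
    simpa using const_mem_polyFun _
  · simpa [Matrix.updateRow_ne h] using hT a b

theorem linearMap_det_mem_polyFun {W : Type*} [AddCommGroup W] [Module K W] [Module.Finite K W]
    (τ : V →ₗ[K] (W →ₗ[K] W)) : (fun x => LinearMap.det (τ x)) ∈ polyFun K V := by
  let b := Module.finBasis K W
  have h : (fun x => LinearMap.det (τ x)) = fun x => (LinearMap.toMatrix b b (τ x)).det := by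
    ext x
    rw [LinearMap.det_toMatrix]
  rw [h]
  refine matrix_det_mem_polyFun fun i j => ?_
  simp only [LinearMap.toMatrix_apply]
  exact dual_mem_polyFun ((b.coord i).comp ((LinearMap.applyₗ (b j)).comp τ))

/-- If the linear maps `L x` depend polynomially on `x` and `L x₀` is surjective, then an element
`e₀` of the kernel of `L x₀` deforms to elements of the kernels of the `L x`. -/
theorem exists_kernel_deformation {E H : Type*} [AddCommGroup E] [Module K E] [AddCommGroup H]
    [Module K H] [Module.Finite K H] (L : V → (E →ₗ[K] H))
    (hL : ∀ (e : E) (l : Module.Dual K H), (fun x => l (L x e)) ∈ polyFun K V)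
    {x₀ : V} (hx₀ : Function.Surjective (L x₀)) {e₀ : E} (he₀ : L x₀ e₀ = 0)
    {D : E → K} (hD : D ∈ polyFun K E) (hDe₀ : D e₀ ≠ 0) :
    ∃ F ∈ polyFun K V, F x₀ ≠ 0 ∧ ∀ x, F x ≠ 0 → ∃ e, L x e = 0 ∧ D e ≠ 0 := by
  obtain ⟨R, hR⟩ := (L x₀).exists_rightInverse_of_surjective (LinearMap.range_eq_top.2 hx₀)
  let b := Module.finBasis K H
  let T : V → Matrix _ _ K := fun x => LinearMap.toMatrix b b (L x ∘ₗ R)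
  have hT : ∀ i j, (fun x => T x i j) ∈ polyFun K V := fun i j => by
    simp only [T, LinearMap.toMatrix_apply]
    exact hL (R (b j)) (b.coord i)
  -- Cramer's rule without denominators: `e₀ - R (L x ∘ R)⁻¹ (L x e₀)` multiplied by the
  -- determinant. This is polynomial in `x`, and it equals `e₀` at `x₀`, where `T` is the identity.
  let G : V → E := fun x => (T x).det • e₀ - R (Matrix.toLin b b (T x).adjugate (L x e₀))
  have hker : ∀ x, L x (G x) = 0 := fun x => by
    have h : (L x ∘ₗ R) ∘ₗ Matrix.toLin b b (T x).adjugate = (T x).det • LinearMap.id := by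
      rw [← Matrix.toLin_toMatrix b b (L x ∘ₗ R), ← Matrix.toLin_mul, Matrix.mul_adjugate]
      simp [T]
    have h' := LinearMap.congr_fun h (L x e₀)
    simp only [LinearMap.comp_apply, LinearMap.smul_apply, LinearMap.id_apply] at h'
    simp [G, h']
  have hG : ∀ l : Module.Dual K E, (fun x => l (G x)) ∈ polyFun K V := fun l => by
    have h : (fun x => l (G x)) = (fun x => (T x).det) * (fun _ => l e₀) -
        ∑ i, (∑ j, (fun x => (T x).adjugate i j) * (fun x => b.coord j (L x e₀))) *
          (fun _ => l (R (b i))) := by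
      ext x
      simp [G, Matrix.toLin_apply, Matrix.mulVec, dotProduct, map_sum]
    rw [h]
    exact sub_mem (mul_mem (matrix_det_mem_polyFun hT) (const_mem_polyFun _))
      (sum_mem fun i _ => mul_mem (sum_mem fun j _ =>
        mul_mem (matrix_adjugate_mem_polyFun hT i j) (hL _ _)) (const_mem_polyFun _))
  refine ⟨fun x => D (G x), comp_mem_polyFun hG hD, ?_, fun x hx => ⟨G x, hker x, hx⟩⟩
  have : G x₀ = e₀ := by simp [G, T, hR, he₀]
  simpa [this] using hDe₀

/-- The restriction of a polynomial function to a line is a polynomial. -/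
theorem exists_polynomial_of_mem_polyFun {F : V → K} (hF : F ∈ polyFun K V) (x y : V) :
    ∃ p : Polynomial K, ∀ t : K, F (x + t • y) = p.eval t := by
  induction hF using Algebra.adjoin_induction with
  | mem f hf =>
    obtain ⟨l, rfl⟩ := hf
    exact ⟨Polynomial.C (l x) + Polynomial.C (l y) * Polynomial.X, fun t => by
      simp only [map_add, map_smul, smul_eq_mul, Polynomial.eval_add, Polynomial.eval_C,
        Polynomial.eval_C_mul, Polynomial.eval_X, mul_comm t]⟩
  | algebraMap r => exact ⟨Polynomial.C r, fun t => by simp⟩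
  | add f g _ _ hf hg =>
    obtain ⟨p, hp⟩ := hf
    obtain ⟨q, hq⟩ := hg
    exact ⟨p + q, fun t => by simp [hp, hq]⟩
  | mul f g _ _ hf hg =>
    obtain ⟨p, hp⟩ := hf
    obtain ⟨q, hq⟩ := hg
    exact ⟨p * q, fun t => by simp [hp, hq]⟩

/-- On the line through `x` and `y` both functions become nonzero polynomials in one variable, and
their product cannot vanish at every element of an infinite field. -/
theorem mul_ne_zero_of_mem_polyFun [Infinite K] {F G : V → K} (hF : F ∈ polyFun K V)
    (hG : G ∈ polyFun K V) {x y : V} (hx : F x ≠ 0) (hy : G y ≠ 0) :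
    ∃ z, F z ≠ 0 ∧ G z ≠ 0 := by
  obtain ⟨p, hp⟩ := exists_polynomial_of_mem_polyFun hF x (y - x)
  obtain ⟨q, hq⟩ := exists_polynomial_of_mem_polyFun hG x (y - x)
  have hp0 : p ≠ 0 := by
    rintro rfl
    exact hx (by simpa using hp 0)
  have hq0 : q ≠ 0 := by
    rintro rfl
    exact hy (by simpa using hq 1)
  by_contra! h
  refine mul_ne_zero hp0 hq0 (Polynomial.funext fun t => ?_)
  rw [Polynomial.eval_mul, Polynomial.eval_zero, ← hp, ← hq]
  by_cases ht : F (x + t • (y - x)) = 0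
  · rw [ht, zero_mul]
  · rw [h _ ht, mul_zero]

variable (K V) in
theorem zariski_isTopologicalBasis : @TopologicalSpace.IsTopologicalBasis V (zariski K V)
    {U | ∃ f ∈ polyFun K V, U = {x | f x ≠ 0}} := by
  let _ := zariski K V
  refine ⟨?_, ?_, rfl⟩
  · rintro _ ⟨f, hf, rfl⟩ _ ⟨g, hg, rfl⟩ x ⟨hx, hx'⟩
    exact ⟨_, ⟨f * g, mul_mem hf hg, rfl⟩, mul_ne_zero hx hx',
      fun y hy => ⟨left_ne_zero_of_mul hy, right_ne_zero_of_mul hy⟩⟩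
  · exact Set.eq_univ_of_forall fun x => ⟨_, ⟨1, one_mem _, rfl⟩, by simp⟩

theorem zariski_isOpen_of_forall {O : Set V}
    (hO : ∀ x ∈ O, ∃ F ∈ polyFun K V, F x ≠ 0 ∧ ∀ y, F y ≠ 0 → y ∈ O) :
    @IsOpen _ (zariski K V) O := by
  let _ := zariski K V
  refine (zariski_isTopologicalBasis K V).isOpen_iff.2 fun x hx => ?_
  obtain ⟨F, hF, h, h'⟩ := hO x hx
  exact ⟨_, ⟨F, hF, rfl⟩, h, h'⟩

/-- A nonempty open subset of a vector space over an infinite field is dense. -/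
theorem zariski_dense_of_isOpen [Infinite K] {O : Set V} (hO : @IsOpen _ (zariski K V) O)
    (hne : O.Nonempty) : @Dense _ (zariski K V) O := by
  let _ := zariski K V
  refine (zariski_isTopologicalBasis K V).dense_iff.2 ?_
  rintro _ ⟨f, hf, rfl⟩ ⟨x, hx⟩
  obtain ⟨y, hy⟩ := hne
  obtain ⟨_, ⟨g, hg, rfl⟩, hgy, hgO⟩ := (zariski_isTopologicalBasis K V).isOpen_iff.1 hO y hy
  obtain ⟨z, hz, hz'⟩ := mul_ne_zero_of_mem_polyFun hf hg hx hgy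
  exact ⟨z, hz, hgO hz'⟩

end Polynomial

/-! ### Dimensions of spaces of homomorphisms -/

section Homs

variable (K : Type*) [Field K] {Λ : Type*} [Ring Λ] [Algebra K Λ]
variable (X Y : Type*) [AddCommGroup X] [Module Λ X] [Module K X] [IsScalarTower K Λ X]
  [AddCommGroup Y] [Module Λ Y] [Module K Y] [IsScalarTower K Λ Y]

theorem finite_linearMap [Module.Finite K X] [Module.Finite K Y] :
    Module.Finite K (X →ₗ[Λ] Y) :=
  Module.Finite.of_injective (LinearMap.restrictScalarsₗ K Λ X Y K)
    (LinearMap.restrictScalars_injective K)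

variable {X} in
theorem finite_submodule [Module.Finite K X] (N : Submodule Λ X) : Module.Finite K N :=
  Module.Finite.of_injective (N.subtype.restrictScalars K) N.injective_subtype

/-- Exactness of `Hom(X, -)` for projective `X`, in terms of dimensions. -/
theorem finrank_hom_of_exact [Module.Projective Λ X] [Module.Finite K X] [Module.Finite K Y]
    {Q C : Type*} [AddCommGroup Q] [Module Λ Q] [Module K Q] [IsScalarTower K Λ Q]
    [AddCommGroup C] [Module Λ C] [Module K C] [IsScalarTower K Λ C]
    {i : Q →ₗ[Λ] Y} {s : Y →ₗ[Λ] C} (hi : Function.Injective i) (hs : Function.Surjective s)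
    (his : Function.Exact i s) :
    Module.finrank K (X →ₗ[Λ] C) + Module.finrank K (X →ₗ[Λ] Q) =
      Module.finrank K (X →ₗ[Λ] Y) := by
  have := finite_linearMap K (Λ := Λ) X Y
  let s' : (X →ₗ[Λ] Y) →ₗ[K] (X →ₗ[Λ] C) :=
    { toFun := fun h => s ∘ₗ h
      map_add' := fun _ _ => LinearMap.comp_add _ _ _
      map_smul' := fun c h => by ext x; simp [LinearMap.map_smul_of_tower] }
  let i' : (X →ₗ[Λ] Q) →ₗ[K] (X →ₗ[Λ] Y) :=
    { toFun := fun h => i ∘ₗ h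
      map_add' := fun _ _ => LinearMap.comp_add _ _ _
      map_smul' := fun c h => by ext x; simp [LinearMap.map_smul_of_tower] }
  have hs' : Function.Surjective s' := fun h => Module.projective_lifting_property s h hs
  have hi' : Function.Injective i' := fun a b hab =>
    LinearMap.ext fun x => hi (LinearMap.congr_fun hab x)
  have hker : LinearMap.ker s' = LinearMap.range i' := by
    ext h
    constructor
    · intro hh
      have hh' : ∀ x, h x ∈ LinearMap.range i := fun x =>
        (his (h x)).1 (LinearMap.congr_fun (LinearMap.mem_ker.1 hh) x)
      refine ⟨(LinearEquiv.ofInjective i hi).symm.toLinearMap ∘ₗ h.codRestrict _ hh', ?_⟩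
      ext x
      exact congrArg Subtype.val ((LinearEquiv.ofInjective i hi).apply_symm_apply ⟨h x, hh' x⟩)
    · rintro ⟨g, rfl⟩
      exact LinearMap.ext fun x => his.apply_apply_eq_zero (g x)
  rw [← LinearMap.finrank_range_add_finrank_ker s', hker,
    LinearMap.finrank_range_of_inj hi', LinearMap.range_eq_top.2 hs', finrank_top]

theorem finrank_hom_pi {ι : Type*} [Fintype ι] (Z : ι → Type*) [∀ x, AddCommGroup (Z x)]
    [∀ x, Module Λ (Z x)] [∀ x, Module K (Z x)] [∀ x, IsScalarTower K Λ (Z x)]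
    [Module.Finite K X] [∀ x, Module.Finite K (Z x)] :
    Module.finrank K (X →ₗ[Λ] (∀ x, Z x)) = ∑ x, Module.finrank K (X →ₗ[Λ] Z x) := by
  have := fun x => finite_linearMap K (Λ := Λ) X (Z x)
  rw [← Module.finrank_pi_fintype]
  exact LinearEquiv.finrank_eq
    { toFun := fun h x => LinearMap.proj x ∘ₗ h
      map_add' := fun _ _ => rfl
      map_smul' := fun _ _ => rfl
      invFun := LinearMap.pi
      left_inv := fun _ => rfl
      right_inv := fun _ => rfl }

/-- A basis of `Hom(X, Y)` over the division ring `End(X)`. -/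
theorem exists_end_basis [Module.Finite K X] [Module.Finite K Y] [Nontrivial X]
    (hX : ∀ h : Module.End Λ X, h ≠ 0 → IsUnit h) :
    ∃ b : Fin (Module.finrank (Module.End Λ X)ᵈᵐᵃ (X →ₗ[Λ] Y)) → (X →ₗ[Λ] Y),
      Function.Bijective fun h : _ → Module.End Λ X => ∑ r, b r ∘ₗ h r := by
  have hu : ∀ a : (Module.End Λ X)ᵈᵐᵃ, IsUnit a ∨ a = 0 := fun a => by
    by_cases h : DomMulAct.mk.symm a = 0
    · exact Or.inr (DomMulAct.mk.symm.injective h)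
    · exact Or.inl ((hX _ h).op)
  have : Nontrivial (Module.End Λ X)ᵈᵐᵃ :=
    inferInstanceAs (Nontrivial (Module.End Λ X)ᵐᵒᵖ)
  let _ : DivisionRing (Module.End Λ X)ᵈᵐᵃ := DivisionRing.ofIsUnitOrEqZero hu
  have hfin := finite_linearMap K (Λ := Λ) X Y
  have : Module.Finite (Module.End Λ X)ᵈᵐᵃ (X →ₗ[Λ] Y) := by
    obtain ⟨s, hs⟩ := hfin.fg_top
    refine ⟨s, top_le_iff.1 fun h _ => ?_⟩
    have hh : h ∈ Submodule.span K (s : Set (X →ₗ[Λ] Y)) := hs ▸ Submodule.mem_top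
    induction hh using Submodule.span_induction with
    | mem x hx => exact Submodule.subset_span hx
    | zero => exact zero_mem _
    | add x y _ _ hx hy => exact add_mem (hx trivial) (hy trivial)
    | smul a x _ hx =>
      -- Scalars of `K` act through `End(X)`, so a finite `K`-spanning set also spans over `End(X)`.
      have : a • x = DomMulAct.mk (a • (1 : Module.End Λ X)) • x := by
        ext z
        simp [DomMulAct.smul_linearMap_apply, LinearMap.map_smul_of_tower]
      rw [this]
      exact Submodule.smul_mem _ _ (hx trivial)
  let b := Module.finBasis (Module.End Λ X)ᵈᵐᵃ (X →ₗ[Λ] Y)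
  refine ⟨b, ?_⟩
  convert (b.equivFun.symm.bijective).comp
    (Function.Bijective.piMap fun _ => DomMulAct.mk.bijective) using 1
  ext h x
  simp [Module.Basis.equivFun_symm_apply, DomMulAct.smul_linearMap_apply]

theorem finrank_hom_eq [Module.Finite K X] [Module.Finite K Y] [Nontrivial X]
    (hX : ∀ h : Module.End Λ X, h ≠ 0 → IsUnit h) :
    Module.finrank K (X →ₗ[Λ] Y) =
      Module.finrank (Module.End Λ X)ᵈᵐᵃ (X →ₗ[Λ] Y) * Module.finrank K (Module.End Λ X) := by
  obtain ⟨b, hb⟩ := exists_end_basis K X Y hX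
  have := finite_linearMap K (Λ := Λ) X X
  let e : (_ → Module.End Λ X) →ₗ[K] (X →ₗ[Λ] Y) :=
    { toFun := fun h => ∑ r, b r ∘ₗ h r
      map_add' := fun _ _ => by simp [LinearMap.comp_add, Finset.sum_add_distrib]
      map_smul' := fun c h => by ext; simp [Finset.smul_sum, LinearMap.map_smul_of_tower] }
  rw [← (LinearEquiv.ofBijective e hb).finrank_eq, Module.finrank_pi_fintype]
  simp

end Homs

theorem projective_powerSum {Λ : Type v} [Ring Λ] {n : ℕ} {P : Fin n → ModuleCat.{v} Λ}
    (hP : ∀ i, Module.Projective Λ (P i)) (γ : Fin n → ℕ) :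
    Module.Projective Λ (PowerSum P γ) :=
  Module.Projective.of_equiv (DFinsupp.linearEquivFunOnFintype (R := Λ)
    (M := fun x : (Σ i : Fin n, Fin (γ i)) => P x.1))

/-! ### Projective covers of simple modules -/

section Covers

variable {Λ : Type v} [Ring Λ] {n : ℕ} {S P : Fin n → ModuleCat.{v} Λ}

namespace IsProjectiveCover

variable {P S : ModuleCat.{v} Λ} {π : P →ₗ[Λ] S} (hπ : IsProjectiveCover π)
  [IsSimpleModule Λ S]

include hπ

theorem le_ker {N : Submodule Λ P} (hN : N ≠ ⊤) : N ≤ LinearMap.ker π := by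
  by_contra h
  have hlt : LinearMap.ker π < N ⊔ LinearMap.ker π := by
    refine lt_of_le_of_ne le_sup_right fun h' => h ?_
    rw [h']
    exact le_sup_left
  exact hN (hπ.superfluous N
    ((LinearMap.isCoatom_ker_of_surjective hπ.surjective).2 _ hlt))

theorem ker_ne_top : LinearMap.ker π ≠ ⊤ :=
  (LinearMap.isCoatom_ker_of_surjective hπ.surjective).1

theorem jacobson_eq_ker : Module.jacobson Λ P = LinearMap.ker π :=
  le_antisymm (sInf_le (LinearMap.isCoatom_ker_of_surjective hπ.surjective))
    (le_sInf fun N hN => by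
      have h := hπ.le_ker hN.1
      rcases hN.le_iff.1 h with h' | h'
      · exact absurd h' hπ.ker_ne_top
      · exact h'.le)

theorem nontrivial : Nontrivial P := by
  have := IsSimpleModule.nontrivial Λ S
  exact hπ.surjective.nontrivial

theorem finite : Module.Finite Λ P := by
  obtain ⟨p, hp⟩ : ∃ p, π p ≠ 0 := by
    by_contra! h
    exact hπ.ker_ne_top (top_le_iff.1 fun p _ => h p)
  refine Module.finite_def.2 ⟨{p}, ?_⟩
  by_contra h
  exact hp (hπ.le_ker h (Submodule.subset_span (by simp)))

/-- A surjection from the projective cover of a simple module onto a projective module is an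
isomorphism. -/
theorem injective_of_surjective {Q : Type*} [AddCommGroup Q] [Module Λ Q]
    [Module.Projective Λ Q] {h : P →ₗ[Λ] Q} (hs : Function.Surjective h) (h0 : h ≠ 0) :
    Function.Injective h := by
  obtain ⟨s, hs'⟩ := Module.projective_lifting_property h LinearMap.id hs
  -- The range of the section `s` and `ker h` together span `P`, and `ker h` lies in the superfluous
  -- submodule `ker π`; hence `s` is onto.
  have hr : LinearMap.range s = ⊤ := by
    refine hπ.superfluous _ (top_le_iff.1 fun p _ => ?_)
    have hker : LinearMap.ker h ≤ LinearMap.ker π :=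
      hπ.le_ker fun h' => h0 (LinearMap.ker_eq_top.1 h')
    have : p = s (h p) + (p - s (h p)) := by abel
    rw [this]
    refine Submodule.add_mem_sup ⟨_, rfl⟩ (hker ?_)
    have := LinearMap.congr_fun hs' (h p)
    simp only [LinearMap.comp_apply, LinearMap.id_apply] at this
    simp [this]
  have hleft : Function.LeftInverse h s := fun q => LinearMap.congr_fun hs' q
  exact (hleft.rightInverse_of_surjective (LinearMap.range_eq_top.1 hr)).injective

end IsProjectiveCover

variable (hS : IsSimpleList S) {π : ∀ i, P i →ₗ[Λ] S i} (hπ : ∀ i, IsProjectiveCover (π i))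

include hS hπ

/-- The kernel of `π i` is the only maximal submodule of `P i`, so a nonzero map to `S j` has this
kernel and identifies `S i` with `S j`. -/
theorem hom_simple_eq_zero {i j : Fin n} (hij : i ≠ j) (h : P i →ₗ[Λ] S j) : h = 0 := by
  have := hS.simple i
  have := hS.simple j
  by_contra h0
  have hs := LinearMap.surjective_of_ne_zero h0
  have hle : LinearMap.ker h ≤ LinearMap.ker (π i) :=
    (hπ i).le_ker (LinearMap.isCoatom_ker_of_surjective hs).1
  have heq : LinearMap.ker h = LinearMap.ker (π i) := by
    rcases (LinearMap.isCoatom_ker_of_surjective hs).le_iff.1 hle with h' | h'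
    · exact absurd h' (hπ i).ker_ne_top
    · exact h'.symm
  exact hij (hS.irredundant i j ⟨(LinearMap.quotKerEquivOfSurjective _ (hπ i).surjective).symm ≪≫ₗ
    Submodule.quotEquivOfEq _ _ heq.symm ≪≫ₗ LinearMap.quotKerEquivOfSurjective _ hs⟩)

/-- The projective covers of the simple modules generate. -/
theorem subsingleton_of_hom_eq_zero {X : Type v} [AddCommGroup X] [Module Λ X]
    (hX : ∀ i (h : P i →ₗ[Λ] X), h = 0) : Subsingleton X := by
  by_contra hne
  rw [not_subsingleton_iff_nontrivial] at hne
  obtain ⟨x, hx⟩ := exists_ne (0 : X)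
  -- A cyclic nonzero module has a maximal submodule; the cover of the simple quotient then lifts to
  -- a nonzero map into `X`.
  let T := LinearMap.range (LinearMap.toSpanSingleton Λ X x)
  have hxT : x ∈ T := ⟨1, by simp⟩
  have : Nontrivial T := ⟨⟨x, hxT⟩, 0, fun h => hx (congrArg Subtype.val h)⟩
  obtain ⟨N, hN, -⟩ := (eq_top_or_exists_le_coatom (⊥ : Submodule Λ T)).resolve_left bot_ne_top
  have hsimple : IsSimpleModule Λ (T ⧸ N) := isSimpleModule_iff_isCoatom.2 hN
  obtain ⟨i, ⟨e⟩⟩ := hS.complete (ModuleCat.of Λ (T ⧸ N)) hsimple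
  have := (hπ i).projective
  have := hS.simple i
  obtain ⟨h, hh⟩ := Module.projective_lifting_property N.mkQ (e.symm.toLinearMap ∘ₗ π i)
    N.mkQ_surjective
  have h0 : h = 0 := by
    ext p
    simpa using LinearMap.congr_fun (hX i (T.subtype ∘ₗ h)) p
  refine (hπ i).ker_ne_top (top_le_iff.1 fun p _ => ?_)
  have := LinearMap.congr_fun hh p
  rw [h0] at this
  simpa using this.symm

end Covers

theorem map_eq_sum_single {Λ : Type v} [Ring Λ] {n : ℕ} {P : Fin n → ModuleCat.{v} Λ}
    {d : Fin n → Fin n → ℕ} {γ : Fin n → ℕ} {X : Type*} [AddCommGroup X] [Module Λ X]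
    (g : (∀ x : (Σ j : Fin n, Fin (γ j)), PowerSum P (d x.1)) →ₗ[Λ] X) (p) :
    g p = ∑ x, ∑ y, g (Pi.single x (Pi.single y (p x y))) := by
  conv_lhs => rw [← Finset.univ_sum_single p, map_sum]
  refine Finset.sum_congr rfl fun x _ => ?_
  conv_lhs => rw [← Finset.univ_sum_single (p x), ← LinearMap.single_apply (R := Λ)
    (φ := fun x : (Σ j : Fin n, Fin (γ j)) => PowerSum P (d x.1)), map_sum, map_sum]
  rfl

/-! ### Presentations given by points of the representation space -/

section Radicals

variable (K : Type u) [Field K] {Λ : Type v} [Ring Λ] [Algebra K Λ] {n : ℕ}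
  {S P : Fin n → ModuleCat.{v} Λ} [∀ i, Module.Finite K (P i)]
  (hS : IsSimpleList S) {π : ∀ i, P i →ₗ[Λ] S i} (hπ : ∀ i, IsProjectiveCover (π i))
  {d : Fin n → Fin n → ℕ} (φ : ∀ j, PowerSum P (d j) ≃ₗ[Λ] Module.jacobson Λ (P j))

include hS hπ in
/-- A surjection between modules of the same dimension vector is injective. -/
theorem injective_of_finrank_hom_eq {X Y : Type v} [AddCommGroup X] [Module Λ X] [Module K X]
    [IsScalarTower K Λ X] [AddCommGroup Y] [Module Λ Y] [Module K Y] [IsScalarTower K Λ Y]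
    [Module.Finite K X] {η : X →ₗ[Λ] Y} (hη : Function.Surjective η)
    (h : ∀ i, Module.finrank K (P i →ₗ[Λ] X) = Module.finrank K (P i →ₗ[Λ] Y)) :
    Function.Injective η := by
  have hker : Subsingleton (LinearMap.ker η) := by
    refine subsingleton_of_hom_eq_zero hS hπ fun i g => ?_
    have := (hπ i).projective
    have h₁ := finrank_hom_of_exact K (P i) X (LinearMap.ker η).injective_subtype
      hη (LinearMap.exact_subtype_ker_map η)
    have := finite_submodule K (LinearMap.ker η)
    have := finite_linearMap K (Λ := Λ) (P i) (LinearMap.ker η)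
    have := Module.finrank_zero_iff.1 (Nat.add_eq_left.1 (h₁.trans (h i)))
    exact Subsingleton.elim _ _
  exact LinearMap.ker_eq_bot.1 (Submodule.subsingleton_iff_eq_bot.1 hker)

include hS hπ in
theorem nonempty_quotient_equiv_of_finrank_hom_eq {X Y : Type v} [AddCommGroup X] [Module Λ X]
    [Module K X] [IsScalarTower K Λ X] [AddCommGroup Y] [Module Λ Y] [Module K Y]
    [IsScalarTower K Λ Y] [Module.Finite K X] {R : Submodule Λ X} {ε : X →ₗ[Λ] Y}
    (hε : Function.Surjective ε) (hR : R ≤ LinearMap.ker ε)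
    (h : ∀ i, Module.finrank K (P i →ₗ[Λ] X ⧸ R) = Module.finrank K (P i →ₗ[Λ] Y)) :
    Nonempty ((X ⧸ R) ≃ₗ[Λ] Y) := by
  have hs : Function.Surjective (R.liftQ ε hR) := fun y => by
    obtain ⟨p, rfl⟩ := hε y
    exact ⟨Submodule.Quotient.mk p, rfl⟩
  have : Module.Finite K (X ⧸ R) :=
    Module.Finite.of_surjective (R.mkQ.restrictScalars K) R.mkQ_surjective
  exact ⟨LinearEquiv.ofBijective (R.liftQ ε hR)
    ⟨injective_of_finrank_hom_eq K hS hπ hs h, hs⟩⟩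

include K hS hπ φ

/-- The indecomposable summands of `rad (P j)` are smaller than `P j`. -/
theorem finrank_lt_of_radical_summand {j : Fin n} (y : Σ i : Fin n, Fin (d j i)) :
    Module.finrank K (P y.1) < Module.finrank K (P j) := by
  have := hS.simple j
  let h : P y.1 →ₗ[Λ] P j := (Module.jacobson Λ (P j)).subtype ∘ₗ (φ j).toLinearMap ∘ₗ
    LinearMap.single Λ (fun y : (Σ i : Fin n, Fin (d j i)) => P y.1) y
  have hinj : Function.Injective h :=
    (Subtype.val_injective.comp (φ j).injective).comp
      (Pi.single_injective (M := fun y : (Σ i : Fin n, Fin (d j i)) => P y.1) y)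
  have hlt : LinearMap.range (h.restrictScalars K) ≠ ⊤ := by
    refine fun htop => (hπ j).ker_ne_top ?_
    rw [← (hπ j).jacobson_eq_ker, eq_top_iff]
    intro p _
    obtain ⟨q, hq⟩ := LinearMap.range_eq_top.1 htop p
    rw [← hq]
    exact (φ j _).2
  rw [← LinearMap.finrank_range_of_inj (f := h.restrictScalars K) hinj]
  exact Submodule.finrank_lt hlt

/-- Induction on the dimension of `P i`. A surjective `h` is an isomorphism because `P i` is
projective. Otherwise `h` lands in the radical, a direct sum of smaller `P`'s, and a nonzero
component is injective by induction. -/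
theorem hom_injective {i j : Fin n} (h : P j →ₗ[Λ] P i) (h0 : h ≠ 0) : Function.Injective h := by
  induction hN : Module.finrank K (P i) using Nat.strong_induction_on generalizing i with
  | _ N ih =>
    have := hS.simple i
    have := hS.simple j
    have := (hπ i).projective
    by_cases hs : LinearMap.range h = ⊤
    · exact (hπ j).injective_of_surjective (LinearMap.range_eq_top.1 hs) h0
    · have hr : ∀ p, h p ∈ Module.jacobson Λ (P i) := fun p => by
        rw [(hπ i).jacobson_eq_ker]
        exact (hπ i).le_ker hs ⟨p, rfl⟩
      let ψ : P j →ₗ[Λ] PowerSum P (d i) := (φ i).symm.toLinearMap ∘ₗ h.codRestrict _ hr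
      obtain ⟨y, hy⟩ : ∃ y, LinearMap.proj y ∘ₗ ψ ≠ 0 := by
        by_contra! hall
        apply h0
        ext p
        have hψ : ψ p = 0 := by
          ext y
          exact LinearMap.congr_fun (hall y) p
        have := (φ i).symm.map_eq_zero_iff.1 hψ
        exact congrArg Subtype.val this
      have hinj := ih _ (hN ▸ finrank_lt_of_radical_summand K hS hπ φ y) _ hy rfl
      intro a b hab
      apply hinj
      have : h.codRestrict _ hr a = h.codRestrict _ hr b := Subtype.ext hab
      simp [ψ, this]

theorem end_isUnit (i : Fin n) (h : Module.End Λ (P i)) (h0 : h ≠ 0) : IsUnit h := by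
  have hinj := hom_injective K hS hπ φ h h0
  exact (Module.End.isUnit_iff h).2 ⟨hinj,
    (LinearMap.injective_iff_surjective (f := h.restrictScalars K)).1 hinj⟩

/-- The map `f - inc : rad P(γ) → P(γ)` is injective. -/
theorem sub_subtype_injective {γ : Fin n → ℕ}
    {f : Module.jacobson Λ (PowerSum P γ) →ₗ[Λ] PowerSum P γ}
    (hf : f ∈ Rep K P d φ γ) :
    Function.Injective (f - (Module.jacobson Λ (PowerSum P γ)).subtype) := by
  let g := f ∘ₗ (radEquiv P d φ γ).toLinearMap
  rw [injective_iff_map_eq_zero]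
  intro q hq
  obtain ⟨p, rfl⟩ := (radEquiv P d φ γ).surjective q
  have hg : ∀ x, g p x = φ x.1 (p x) := fun x =>
    congrFun (sub_eq_zero.1 (LinearMap.sub_apply f _ _ ▸ hq)) x
  obtain ⟨B, hB⟩ : ∃ B, ∀ j, Module.finrank K (P j) ≤ B :=
    ⟨∑ j, Module.finrank K (P j), fun j =>
      Finset.single_le_sum (f := fun j => Module.finrank K (P j)) (fun _ _ => Nat.zero_le _)
        (Finset.mem_univ j)⟩
  -- Descending induction on the dimension of `P x.1`. By the block condition, component `x` of `g
  -- p` only receives summands `P y.1` with `y.1 = x.1`. Such a summand sits in the radical of a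
  -- strictly larger `P x'.1`, where `p` already vanishes. The bound `B` keeps the truncated
  -- subtraction strictly monotone.
  have key : ∀ (N : ℕ) (x : Σ j : Fin n, Fin (γ j)),
      B - Module.finrank K (P x.1) = N → p x = 0 := by
    intro N
    induction N using Nat.strong_induction_on with
    | _ N ih =>
      intro x hx
      rw [← (φ x.1).map_eq_zero_iff, ← Subtype.coe_inj, ← hg x,
        map_eq_sum_single g p, Finset.sum_apply]
      refine Finset.sum_eq_zero fun x' _ => ?_
      rw [Finset.sum_apply]
      refine Finset.sum_eq_zero fun y _ => ?_
      by_cases hy : x.1 = y.1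
      · have hlt := finrank_lt_of_radical_summand K hS hπ φ y
        rw [← hy] at hlt
        have hp : p x' = 0 := ih _ (by have := hB x'.1; omega) x' rfl
        simp [hp]
      · exact hf x' y _ x hy
  have hp : p = 0 := funext fun x => key _ x rfl
  rw [hp, map_zero]

/-- Composition with `π i` is onto by projectivity, and injective because a nonzero endomorphism of
`P i` is surjective. -/
theorem finrank_hom_simple (i : Fin n) :
    Module.finrank K (P i →ₗ[Λ] S i) = Module.finrank K (Module.End Λ (P i)) := by
  have := hS.simple i
  have := (hπ i).projective
  have := finite_linearMap K (Λ := Λ) (P i) (P i)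
  let s : Module.End Λ (P i) →ₗ[K] (P i →ₗ[Λ] S i) :=
    { toFun := fun h => π i ∘ₗ h
      map_add' := fun _ _ => LinearMap.comp_add _ _ _
      map_smul' := fun c h => by ext x; simp [LinearMap.map_smul_of_tower] }
  refine (LinearEquiv.ofBijective s ⟨?_, fun h =>
    Module.projective_lifting_property (π i) h (hπ i).surjective⟩).finrank_eq.symm
  rw [injective_iff_map_eq_zero]
  intro h hh
  by_contra h0
  obtain ⟨-, hsurj⟩ := (Module.End.isUnit_iff h).1 (end_isUnit K hS hπ φ i h h0)
  refine (hπ i).ker_ne_top (top_le_iff.1 fun p _ => ?_)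
  obtain ⟨q, rfl⟩ := hsurj p
  exact LinearMap.congr_fun hh q

variable [∀ i, Module.Finite K (S i)]

/-- The dimension vector of `N_f` is `γ`. -/
theorem finrank_hom_repModule {γ : Fin n → ℕ}
    {f : Module.jacobson Λ (PowerSum P γ) →ₗ[Λ] PowerSum P γ} (hf : f ∈ Rep K P d φ γ) (i : Fin n) :
    Module.finrank K (P i →ₗ[Λ] repModule f) =
      γ i * Module.finrank K (Module.End Λ (P i)) := by
  have := (hπ i).projective
  -- Both `f - inc` and `inc` embed `rad P(γ)` in `P(γ)`, so their cokernels `N_f` and `S(γ)` have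
  -- the same dimensions of `Hom(P i, -)`.
  have h₁ := finrank_hom_of_exact K (P i) (PowerSum P γ) (sub_subtype_injective K hS hπ φ hf)
    (Submodule.mkQ_surjective _) (LinearMap.exact_map_mkQ_range _)
  let s : PowerSum P γ →ₗ[Λ] PowerSum S γ := LinearMap.pi fun x => π x.1 ∘ₗ LinearMap.proj x
  have hs : Function.Surjective s := fun q => by
    choose p hp using fun x : (Σ i : Fin n, Fin (γ i)) => (hπ x.1).surjective (q x)
    exact ⟨p, funext hp⟩
  have hker : Function.Exact (Module.jacobson Λ (PowerSum P γ)).subtype s := by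
    intro p
    have h : Module.jacobson Λ (PowerSum P γ) = LinearMap.ker s := by
      rw [jacobson_powerSum]
      ext p
      simp only [Submodule.mem_pi, Set.mem_univ, true_implies, LinearMap.mem_ker, funext_iff]
      refine forall_congr' fun x => ?_
      have := hS.simple x.1
      rw [(hπ x.1).jacobson_eq_ker]
      rfl
    rw [← LinearMap.mem_ker, ← h]
    simp
  have h₂ := finrank_hom_of_exact K (P i) (PowerSum P γ) (Submodule.subtype_injective _) hs hker
  have h₃ : Module.finrank K (P i →ₗ[Λ] PowerSum S γ) =
      γ i * Module.finrank K (Module.End Λ (P i)) := by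
    rw [finrank_hom_pi, Fintype.sum_sigma, Finset.sum_eq_single i]
    · simp [finrank_hom_simple K hS hπ φ i]
    · intro j _ hj
      refine Finset.sum_eq_zero fun r _ => ?_
      have : Subsingleton (P i →ₗ[Λ] S j) :=
        ⟨fun a b => by rw [hom_simple_eq_zero hS hπ hj.symm a, hom_simple_eq_zero hS hπ hj.symm b]⟩
      exact Module.finrank_zero_of_subsingleton
    · simp
  rw [← h₃]
  exact Nat.add_right_cancel (h₁.trans h₂.symm)

theorem nonempty_repModule_equiv {X : ModuleCat.{v} Λ} [Module.Finite K X]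
    {f : Module.jacobson Λ (PowerSum P (dimVec P X)) →ₗ[Λ] PowerSum P (dimVec P X)}
    (hf : f ∈ Rep K P d φ (dimVec P X)) {ε : PowerSum P (dimVec P X) →ₗ[Λ] X}
    (hεs : Function.Surjective ε)
    (hle : LinearMap.range (f - (Module.jacobson Λ (PowerSum P (dimVec P X))).subtype) ≤
      LinearMap.ker ε) : Nonempty (repModule f ≃ₗ[Λ] X) := by
  have hproj := fun i => (hπ i).projective
  have hnt : ∀ i, Nontrivial (P i) := fun i => by
    have := hS.simple i
    exact (hπ i).nontrivial
  exact nonempty_quotient_equiv_of_finrank_hom_eq K hS hπ hεs hle fun i =>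
    (finrank_hom_repModule K hS hπ φ hf i).trans
      (finrank_hom_eq K (P i) X (end_isUnit K hS hπ φ i)).symm

/-- Every module with dimension vector `γ` is represented by a point of `Rep(Λ, γ)`. -/
theorem exists_repModule_equiv {γ : Fin n → ℕ} (X : ModuleCat.{v} Λ) [Module.Finite K X]
    (hX : dimVec P X = γ) : ∃ f ∈ Rep K P d φ γ, Nonempty (repModule f ≃ₗ[Λ] X) := by
  have hu := end_isUnit K hS hπ φ
  have hnt : ∀ i, Nontrivial (P i) := fun i => by
    have := hS.simple i
    exact (hπ i).nontrivial
  have hproj := fun i => (hπ i).projective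
  subst hX
  choose b hb using fun i => exists_end_basis K (P i) X (hu i)
  -- The bases of the spaces `Hom(P i, X)` assemble to `ε`. Every map `P i → X` lifts along `ε` to a
  -- map `c i h` with values in the block `P i ^ (γ i)`.
  let ε : PowerSum P (dimVec P X) →ₗ[Λ] X := LinearMap.lsum Λ _ ℕ fun x => b x.1 x.2
  have hε : ∀ (i : Fin n) (r : Fin (dimVec P X i)) (q : P i),
      ε (Pi.single (⟨i, r⟩ : Σ i : Fin n, Fin (dimVec P X i)) q) = b i r q := fun i r q => by
    exact LinearMap.lsum_piSingle Λ _ ℕ _ _ _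
  let c : ∀ i, (P i →ₗ[Λ] X) → (P i →ₗ[Λ] PowerSum P (dimVec P X)) := fun i h =>
    ∑ r, LinearMap.single Λ (fun x : (Σ i : Fin n, Fin (dimVec P X i)) => P x.1) ⟨i, r⟩ ∘ₗ
      (Function.surjInv (hb i).2 h) r
  have hc : ∀ i h, ε ∘ₗ c i h = h := fun i h => by
    conv_rhs => rw [← Function.surjInv_eq (hb i).2 h]
    ext q
    simp only [c, LinearMap.comp_apply, LinearMap.sum_apply, map_sum, LinearMap.single_apply]
    exact Finset.sum_congr rfl fun r _ => hε _ _ _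
  have hc' : ∀ i h q (z : Σ i : Fin n, Fin (dimVec P X i)), z.1 ≠ i → c i h q z = 0 := by
    intro i h q z hz
    simp only [c, LinearMap.sum_apply, Finset.sum_apply]
    refine Finset.sum_eq_zero fun r _ => ?_
    refine Pi.single_eq_of_ne ?_ _
    rintro rfl
    exact hz rfl
  have hεs : Function.Surjective ε := by
    have : Subsingleton (X ⧸ LinearMap.range ε) := by
      refine subsingleton_of_hom_eq_zero hS hπ fun i h => ?_
      obtain ⟨h', rfl⟩ := Module.projective_lifting_property (LinearMap.range ε).mkQ h
        (Submodule.mkQ_surjective _)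
      ext q
      simp only [LinearMap.comp_apply, Submodule.mkQ_apply, LinearMap.zero_apply,
        Submodule.Quotient.mk_eq_zero]
      exact ⟨c i h' q, LinearMap.congr_fun (hc i h') q⟩
    exact LinearMap.range_eq_top.1 (Submodule.Quotient.subsingleton_iff.1 this)
  let ρ := radEquiv P d φ (dimVec P X)
  let v : (∀ x : (Σ j : Fin n, Fin (dimVec P X j)), PowerSum P (d x.1)) →ₗ[Λ] X :=
    ε ∘ₗ (Module.jacobson Λ (PowerSum P (dimVec P X))).subtype ∘ₗ ρ.toLinearMap
  -- Lifting `v` summand by summand with `c` gives the block condition for `g` together with `ε ∘ g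
  -- = v`, that is, `ε ∘ (f - inc) = 0`.
  let g : (∀ x : (Σ j : Fin n, Fin (dimVec P X j)), PowerSum P (d x.1)) →ₗ[Λ]
      PowerSum P (dimVec P X) :=
    LinearMap.lsum Λ _ ℕ fun x => LinearMap.lsum Λ _ ℕ fun y =>
      c y.1 (v ∘ₗ LinearMap.single Λ (fun x : (Σ j : Fin n, Fin (dimVec P X j)) =>
        PowerSum P (d x.1)) x ∘ₗ LinearMap.single Λ (fun y : (Σ i : Fin n, Fin (d x.1 i)) =>
          P y.1) y)
  have hg : ∀ x y q, g (Pi.single x (Pi.single y q)) =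
      c y.1 (v ∘ₗ LinearMap.single Λ (fun x : (Σ j : Fin n, Fin (dimVec P X j)) =>
        PowerSum P (d x.1)) x ∘ₗ LinearMap.single Λ (fun y : (Σ i : Fin n, Fin (d x.1 i)) =>
          P y.1) y) q := fun x y q => by
    exact (LinearMap.lsum_piSingle Λ _ ℕ _ _ _).trans (LinearMap.lsum_piSingle Λ _ ℕ _ _ _)
  have hgv : ∀ p, ε (g p) = v p := fun p => by
    change (ε ∘ₗ g) p = v p
    rw [map_eq_sum_single (ε ∘ₗ g), map_eq_sum_single v]
    refine Finset.sum_congr rfl fun x _ => Finset.sum_congr rfl fun y _ => ?_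
    rw [LinearMap.comp_apply, hg]
    exact LinearMap.congr_fun (hc _ _) _
  let f := g ∘ₗ ρ.symm.toLinearMap
  have hf : f ∈ Rep K P d φ (dimVec P X) := by
    intro x y p z hz
    have : (f ∘ₗ (radEquiv P d φ (dimVec P X)).toLinearMap) = g := by
      refine LinearMap.ext fun p => ?_
      exact congrArg g (ρ.symm_apply_apply p)
    rw [this, hg]
    exact hc' _ _ _ _ hz
  refine ⟨f, hf, nonempty_repModule_equiv K hS hπ φ hf hεs ?_⟩
  rintro _ ⟨q, rfl⟩
  rw [LinearMap.mem_ker, LinearMap.sub_apply, map_sub, sub_eq_zero]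
  refine (hgv (ρ.symm q)).trans ?_
  exact congrArg (fun q => ε (Subtype.val q)) (ρ.apply_symm_apply q)

end Radicals

/-! ### Rigid modules and first-order deformations -/

section Rigid

/-- `Ext¹(N, N)` vanishes if `N` is a direct summand of a finite direct sum of objects between
which `Ext¹` vanishes. -/
theorem subsingleton_ext_of_sum_eq_id {C : Type*} [Category C] [Abelian C] [HasExt C] {ι : Type*}
    [Fintype ι] {X : ι → C} {N : C} (p : ∀ x, N ⟶ X x) (a : ∀ x, X x ⟶ N)
    (hpa : ∑ x, p x ≫ a x = 𝟙 N) (hX : ∀ x y, Subsingleton (Abelian.Ext (X x) (X y) 1)) :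
    Subsingleton (Abelian.Ext N N 1) := by
  have h₁ : ∀ x (e : Abelian.Ext (X x) N 1), e = 0 := fun x e => by
    rw [← Abelian.Ext.comp_mk₀_id e, ← hpa, Abelian.Ext.mk₀_sum, Abelian.Ext.comp_sum]
    refine Finset.sum_eq_zero fun y _ => ?_
    rw [← Abelian.Ext.mk₀_comp_mk₀, ← Abelian.Ext.comp_assoc_of_third_deg_zero,
      Subsingleton.elim (e.comp (Abelian.Ext.mk₀ (p y)) (add_zero 1)) 0, Abelian.Ext.zero_comp]
  have h₂ : ∀ e : Abelian.Ext N N 1, e = 0 := fun e => by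
    rw [← Abelian.Ext.mk₀_id_comp e, ← hpa, Abelian.Ext.mk₀_sum, Abelian.Ext.sum_comp]
    refine Finset.sum_eq_zero fun y _ => ?_
    rw [← Abelian.Ext.mk₀_comp_mk₀_assoc, h₁ y (Abelian.Ext.comp _ e _), Abelian.Ext.comp_zero]
  exact ⟨fun e e' => by rw [h₂ e, h₂ e']⟩

variable {Λ : Type v} [Ring Λ]

theorem subsingleton_ext_powerSum {k : ℕ} {M : Fin k → ModuleCat.{v} Λ}
    (hM : ∀ i j, Subsingleton (Abelian.Ext (M i) (M j) 1)) (m : Fin k → ℕ) {N : Type v}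
    [AddCommGroup N] [Module Λ N] (e : N ≃ₗ[Λ] PowerSum M m) :
    Subsingleton (Abelian.Ext (ModuleCat.of Λ N) (ModuleCat.of Λ N) 1) := by
  refine subsingleton_ext_of_sum_eq_id (X := fun x : (Σ i : Fin k, Fin (m i)) => M x.1)
    (fun x => ModuleCat.ofHom (LinearMap.proj x ∘ₗ e.toLinearMap))
    (fun x => ModuleCat.ofHom (e.symm.toLinearMap ∘ₗ
      LinearMap.single Λ (fun x : (Σ i : Fin k, Fin (m i)) => (M x.1 : Type v)) x))
    ?_ fun x y => hM _ _
  ext z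
  apply e.injective
  simp only [← ModuleCat.ofHom_comp, ModuleCat.hom_sum, ModuleCat.hom_ofHom, LinearMap.sum_apply,
    LinearMap.comp_apply, map_sum, LinearEquiv.coe_coe, LinearEquiv.apply_symm_apply,
    LinearMap.single_apply, LinearMap.proj_apply, ModuleCat.hom_id, LinearMap.id_apply]
  exact Finset.univ_sum_single (e z)

/-- If `Ext¹(Y / Q, Z) = 0`, then homomorphisms `Q → Z` extend to `Y`. -/
theorem exists_extension_of_subsingleton_ext {Q Y Z : Type v} [AddCommGroup Q] [Module Λ Q]
    [AddCommGroup Y] [Module Λ Y] [AddCommGroup Z] [Module Λ Z] {i : Q →ₗ[Λ] Y}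
    (hi : Function.Injective i)
    (hext : Subsingleton (Abelian.Ext (ModuleCat.of Λ (Y ⧸ LinearMap.range i))
      (ModuleCat.of Λ Z) 1)) (h : Q →ₗ[Λ] Z) : ∃ a : Y →ₗ[Λ] Z, a ∘ₗ i = h := by
  let T : ShortComplex (ModuleCat.{v} Λ) :=
    ShortComplex.mk (ModuleCat.ofHom i) (ModuleCat.ofHom (LinearMap.range i).mkQ) (by
      ext q
      exact (LinearMap.exact_map_mkQ_range i).apply_apply_eq_zero q)
  have hT : T.ShortExact := ModuleCat.shortComplex_shortExact T
    (LinearMap.exact_map_mkQ_range i) hi (Submodule.mkQ_surjective _)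
  -- The obstruction to extending `h` is its product with the extension class, which lies in a
  -- vanishing `Ext¹`.
  obtain ⟨x, hx⟩ := Abelian.Ext.contravariant_sequence_exact₁ hT (ModuleCat.of Λ Z)
    (Abelian.Ext.mk₀ (ModuleCat.ofHom h)) (add_zero 1) (@Subsingleton.elim _ hext _ _)
  obtain ⟨a, rfl⟩ := (Abelian.Ext.mk₀_bijective _ _).2 x
  rw [Abelian.Ext.mk₀_comp_mk₀] at hx
  have := (Abelian.Ext.mk₀_bijective _ _).1 hx
  exact ⟨a.hom, congrArg ModuleCat.Hom.hom this⟩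

/-- For a presentation `i : Q → Y` of a rigid module, every homomorphism `Q → Y` is an
infinitesimal deformation of `i` along the automorphisms of `Q` and `Y`. -/
theorem exists_comp_sub_comp_eq {Q Y : Type v} [AddCommGroup Q] [Module Λ Q] [AddCommGroup Y]
    [Module Λ Y] [Module.Projective Λ Y] {i : Q →ₗ[Λ] Y} (hi : Function.Injective i)
    (hext : Subsingleton (Abelian.Ext (ModuleCat.of Λ (Y ⧸ LinearMap.range i))
      (ModuleCat.of Λ (Y ⧸ LinearMap.range i)) 1)) (h : Q →ₗ[Λ] Y) :
    ∃ (A : Y →ₗ[Λ] Y) (B : Q →ₗ[Λ] Q), A ∘ₗ i - i ∘ₗ B = h := by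
  -- Modulo the range of `i`, the map `h` extends to `Y`, and projectivity lifts the extension to
  -- `A`. Then `A i - h` takes values in the range of `i`, so it factors as `i B`.
  obtain ⟨a, ha⟩ := exists_extension_of_subsingleton_ext hi hext ((LinearMap.range i).mkQ ∘ₗ h)
  obtain ⟨A, rfl⟩ := Module.projective_lifting_property (LinearMap.range i).mkQ a
    (Submodule.mkQ_surjective _)
  have hmem : ∀ q, (A ∘ₗ i - h) q ∈ LinearMap.range i := fun q => by
    rw [← Submodule.Quotient.mk_eq_zero, LinearMap.sub_apply, Submodule.Quotient.mk_sub,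
      sub_eq_zero]
    exact LinearMap.congr_fun ha q
  refine ⟨A, (LinearEquiv.ofInjective i hi).symm.toLinearMap ∘ₗ
    (A ∘ₗ i - h).codRestrict _ hmem, ?_⟩
  ext q
  have : i ((LinearEquiv.ofInjective i hi).symm ⟨(A ∘ₗ i - h) q, hmem q⟩) = (A ∘ₗ i - h) q :=
    congrArg Subtype.val ((LinearEquiv.ofInjective i hi).apply_symm_apply _)
  rw [LinearMap.sub_apply, sub_eq_iff_eq_add, LinearMap.comp_apply i]
  refine Eq.trans ?_ (congrArg (h q + ·) this.symm)
  simp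

end Rigid

/-! ### Local constancy of cokernels -/

section Deformation

variable {K : Type u} [Field K] {Λ : Type v} [Ring Λ] [Algebra K Λ]
  {V : Type v} [AddCommGroup V] [Module K V]
  {Q Y : Type v} [AddCommGroup Q] [Module Λ Q] [Module K Q] [IsScalarTower K Λ Q]
  [Module.Finite K Q] [AddCommGroup Y] [Module Λ Y] [Module K Y] [IsScalarTower K Λ Y]
  [Module.Finite K Y]

theorem bijective_of_det_ne_zero {A : Y →ₗ[Λ] Y}
    (hA : LinearMap.det (A.restrictScalars K) ≠ 0) : Function.Bijective A :=
  (Module.End.isUnit_iff (A.restrictScalars K)).1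
    ((LinearMap.isUnit_iff_isUnit_det _).2 (isUnit_iff_ne_zero.2 hA))

/-- The cokernels of a family of homomorphisms are locally constant where the deformations are
trivial to first order. -/
theorem exists_polyFun_nonempty_coker_equiv (θ : V →ₗ[K] (Q →ₗ[Λ] Y)) (c : Q →ₗ[Λ] Y) (x₀ : V)
    (hsurj : ∀ h : Q →ₗ[Λ] Y, ∃ (A : Y →ₗ[Λ] Y) (B : Q →ₗ[Λ] Q),
      A ∘ₗ (θ x₀ - c) - (θ x₀ - c) ∘ₗ B = h) :
    ∃ F ∈ polyFun K V, F x₀ ≠ 0 ∧ ∀ x, F x ≠ 0 →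
      Nonempty ((Y ⧸ LinearMap.range (θ x - c)) ≃ₗ[Λ] Y ⧸ LinearMap.range (θ x₀ - c)) := by
  have := finite_linearMap K (Λ := Λ) Q Y
  -- The kernel of `L x` consists of the morphisms from the presentation at `x₀` to the one at `x`;
  -- at `x₀` it contains the pair of identities.
  let L : V → ((Y →ₗ[Λ] Y) × (Q →ₗ[Λ] Q)) →ₗ[K] (Q →ₗ[Λ] Y) := fun x =>
    { toFun := fun e => e.1 ∘ₗ (θ x₀ - c) - (θ x - c) ∘ₗ e.2
      map_add' := fun e e' => by
        simp only [Prod.fst_add, Prod.snd_add, LinearMap.add_comp, LinearMap.comp_add]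
        abel
      map_smul' := fun r e => by
        ext q
        simp [LinearMap.map_smul_of_tower, smul_sub] }
  have hL : ∀ e (l : Module.Dual K (Q →ₗ[Λ] Y)), (fun x => l (L x e)) ∈ polyFun K V := by
    intro e l
    let l' : Module.Dual K V :=
      { toFun := fun x => l (θ x ∘ₗ e.2)
        map_add' := fun x y => by rw [map_add, LinearMap.add_comp, map_add]
        map_smul' := fun r x => by
          rw [map_smul, LinearMap.smul_comp, map_smul, RingHom.id_apply] }
    have h : (fun x => l (L x e)) =
        (fun _ => l (e.1 ∘ₗ (θ x₀ - c) + c ∘ₗ e.2)) - fun x => l' x := by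
      ext x
      change l (e.1 ∘ₗ (θ x₀ - c) - (θ x - c) ∘ₗ e.2) =
        l (e.1 ∘ₗ (θ x₀ - c) + c ∘ₗ e.2) - l (θ x ∘ₗ e.2)
      rw [← map_sub, LinearMap.sub_comp]
      congr 1
      abel
    rw [h]
    exact sub_mem (const_mem_polyFun _) (dual_mem_polyFun l')
  -- Where this product of determinants is nonzero, both components of the morphism are invertible.
  have hD : (fun e : (Y →ₗ[Λ] Y) × (Q →ₗ[Λ] Q) => LinearMap.det (e.1.restrictScalars K)) *
      (fun e => LinearMap.det (e.2.restrictScalars K)) ∈ polyFun K _ :=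
    mul_mem
      (linearMap_det_mem_polyFun (LinearMap.restrictScalarsₗ K Λ Y Y K ∘ₗ
        LinearMap.fst K (Y →ₗ[Λ] Y) (Q →ₗ[Λ] Q)))
      (linearMap_det_mem_polyFun (LinearMap.restrictScalarsₗ K Λ Q Q K ∘ₗ
        LinearMap.snd K (Y →ₗ[Λ] Y) (Q →ₗ[Λ] Q)))
  obtain ⟨F, hF, hF₀, hFx⟩ := exists_kernel_deformation L hL (x₀ := x₀)
    (fun h => by
      obtain ⟨A, B, hAB⟩ := hsurj h
      exact ⟨(A, B), hAB⟩)
    (e₀ := (LinearMap.id, LinearMap.id)) (by simp [L]) hD (by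
      change LinearMap.det (LinearMap.id : Y →ₗ[K] Y) * LinearMap.det (LinearMap.id : Q →ₗ[K] Q) ≠ 0
      simp)
  refine ⟨F, hF, hF₀, fun x hx => ?_⟩
  obtain ⟨⟨A, B⟩, hAB, hdet⟩ := hFx x hx
  have hA := bijective_of_det_ne_zero (left_ne_zero_of_mul hdet)
  have hB := bijective_of_det_ne_zero (right_ne_zero_of_mul hdet)
  have hAB' : A ∘ₗ (θ x₀ - c) = (θ x - c) ∘ₗ B := sub_eq_zero.1 hAB
  refine ⟨(Submodule.Quotient.equiv _ _ (LinearEquiv.ofBijective A hA) ?_).symm⟩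
  change Submodule.map A _ = _
  rw [← LinearMap.range_comp, hAB', LinearMap.range_comp_of_range_eq_top _
    (LinearMap.range_eq_top.2 hB.2)]

/-- The locus where the cokernel is isomorphic to a given rigid module is open. -/
theorem exists_polyFun_of_rigid_coker [Module.Projective Λ Y] (W : Submodule K (Q →ₗ[Λ] Y))
    (c : Q →ₗ[Λ] Y) (f : W) (hi : Function.Injective (f.1 - c)) {N : Type v} [AddCommGroup N]
    [Module Λ N] (e : (Y ⧸ LinearMap.range (f.1 - c)) ≃ₗ[Λ] N)
    (hext : Subsingleton (Abelian.Ext (ModuleCat.of Λ (Y ⧸ LinearMap.range (f.1 - c)))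
      (ModuleCat.of Λ (Y ⧸ LinearMap.range (f.1 - c))) 1)) :
    ∃ F ∈ polyFun K W, F f ≠ 0 ∧ ∀ g : W, F g ≠ 0 →
      Nonempty ((Y ⧸ LinearMap.range (g.1 - c)) ≃ₗ[Λ] N) := by
  obtain ⟨F, hF, hFf, hFg⟩ := exists_polyFun_nonempty_coker_equiv W.subtype c f
    (exists_comp_sub_comp_eq hi hext)
  refine ⟨F, hF, hFf, fun g hg => ?_⟩
  obtain ⟨e'⟩ := hFg g hg
  exact ⟨e' ≪≫ₗ e⟩

end Deformation

/-! ### Additivity of dimension vectors and openness of the rigid locus -/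

section Generic

variable (K : Type u) [Field K] {Λ : Type v} [Ring Λ] [Algebra K Λ] {n : ℕ}
  {S P : Fin n → ModuleCat.{v} Λ} [∀ i, Module.Finite K (P i)]
  (hS : IsSimpleList S) {π : ∀ i, P i →ₗ[Λ] S i} (hπ : ∀ i, IsProjectiveCover (π i))
  {d : Fin n → Fin n → ℕ} (φ : ∀ j, PowerSum P (d j) ≃ₗ[Λ] Module.jacobson Λ (P j))
  {k : ℕ} {M : Fin k → ModuleCat.{v} Λ}

include K hS hπ φ in
/-- The dimension vector is additive on direct sums. -/
theorem dimVec_powerSum [∀ i, Module.Finite K (M i)] (m : Fin k → ℕ) :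
    dimVec P (ModuleCat.of Λ (PowerSum M m)) = ∑ i, m i • dimVec P (M i) := by
  ext i
  have := hS.simple i
  have := (hπ i).nontrivial
  have := finite_linearMap K (Λ := Λ) (P i) (P i)
  have hu := end_isUnit K hS hπ φ i
  have h := finrank_hom_eq K (P i) (PowerSum M m) hu
  rw [finrank_hom_pi, Fintype.sum_sigma] at h
  simp only [finrank_hom_eq K (P i) (M _) hu, Finset.sum_const, Finset.card_univ,
    Fintype.card_fin, smul_eq_mul, ← mul_assoc, ← Finset.sum_mul] at h
  have hpos : 0 < Module.finrank K (Module.End Λ (P i)) := Module.finrank_pos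
  rw [Finset.sum_apply]
  exact (Nat.eq_of_mul_eq_mul_right hpos h).symm

include hS hπ in
/-- The locus of a rigid module is open. -/
theorem isOpen_isoLocus (hext : ∀ i j, Subsingleton (Abelian.Ext (M i) (M j) 1)) (m : Fin k → ℕ)
    (γ : Fin n → ℕ) :
    @IsOpen _ (zariski K _) (isoLocus K P d φ γ (PowerSum M m)) := by
  have := projective_powerSum (fun i => (hπ i).projective) γ
  have := finite_submodule K (Module.jacobson Λ (PowerSum P γ))
  refine zariski_isOpen_of_forall fun f hf => ?_
  obtain ⟨e⟩ := hf
  exact exists_polyFun_of_rigid_coker (Rep K P d φ γ)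
    (Module.jacobson Λ (PowerSum P γ)).subtype f (sub_subtype_injective K hS hπ φ f.2) e
    (subsingleton_ext_powerSum hext m e)

end Generic

end GenericDecomposition

theorem corollary2p1p8
    {K : Type u} [Field K] [Infinite K]
    {Λ : Type v} [Ring Λ] [Algebra K Λ] [Module.Finite K Λ]
    (hΛ : GenericDecomposition.IsHereditary Λ)
    {n : ℕ} (S P : Fin n → ModuleCat.{v} Λ)
    (hS : GenericDecomposition.IsSimpleList S)
    (π : ∀ i, P i →ₗ[Λ] S i)
    (hπ : ∀ i, GenericDecomposition.IsProjectiveCover (π i))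
    (φ : ∀ j, GenericDecomposition.PowerSum P (GenericDecomposition.extDim S j) ≃ₗ[Λ]
      Module.jacobson Λ (P j))
    {k : ℕ} (α : Fin k → Fin n → ℕ)
    (hα : ∀ i, GenericDecomposition.IsRealSchurRoot P (α i))
    (M : Fin k → ModuleCat.{v} Λ)
    (hM : ∀ i, GenericDecomposition.IsExceptional (M i))
    (hdim : ∀ i, GenericDecomposition.dimVec P (M i) = α i)
    (hext : ∀ i j, Subsingleton (CategoryTheory.Abelian.Ext (M i) (M j) 1))
    (m : Fin k → ℕ) (γ : Fin n → ℕ) (hγ : γ = ∑ i, m i • α i) :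
    @IsOpen _ (GenericDecomposition.zariski K _)
      (GenericDecomposition.isoLocus K P (GenericDecomposition.extDim S) φ γ
        (GenericDecomposition.PowerSum M m)) ∧
    @Dense _ (GenericDecomposition.zariski K _)
      (GenericDecomposition.isoLocus K P (GenericDecomposition.extDim S) φ γ
        (GenericDecomposition.PowerSum M m)) := by
  -- Heredity enters through `φ`, which makes the radicals of the `P j` projective.
  have hPΛ : ∀ i, Module.Finite Λ (P i) := fun i =>
    have := hS.simple i
    (hπ i).finite
  have hP : ∀ i, Module.Finite K (P i) := fun i => Module.Finite.trans Λ _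
  have hSK : ∀ i, Module.Finite K (S i) := fun i =>
    Module.Finite.of_surjective ((π i).restrictScalars K) (hπ i).surjective
  have hMΛ : ∀ i, Module.Finite Λ (M i) := fun i => (hM i).finite
  have hMK : ∀ i, Module.Finite K (M i) := fun i => Module.Finite.trans Λ _
  have hopen := GenericDecomposition.isOpen_isoLocus K hS hπ φ hext m γ
  refine ⟨hopen, GenericDecomposition.zariski_dense_of_isOpen hopen ?_⟩
  have : Module.Finite K (ModuleCat.of Λ (GenericDecomposition.PowerSum M m)) :=
    have : Module.Finite Λ (GenericDecomposition.PowerSum M m) := inferInstance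
    Module.Finite.trans Λ _
  obtain ⟨f, hf, he⟩ := GenericDecomposition.exists_repModule_equiv K hS hπ φ (γ := γ)
    (ModuleCat.of Λ (GenericDecomposition.PowerSum M m))
    (by rw [GenericDecomposition.dimVec_powerSum K hS hπ φ, hγ]; simp only [hdim])
  exact ⟨⟨f, hf⟩, he⟩
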